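/- Let $D\subset\mathbb{R}^d$ be open and bounded and let $\tilde k:D\times D\to\mathbb{R}$ be a continuous symmetric positive semidefinite kernel with $\int_D \tilde k(x,x)\,dx<\infty$ (for instance, $\tilde k$ bounded). Let $H(D)=H_{\tilde k}(D)$ be the reproducing kernel Hilbert space of functions on $D$ with kernel $\tilde k$ and norm $\|\cdot\|_{\tilde k}$, and define the integral-type kernel $$\hat k(x,x')=\int_D \tilde k(x,z)\,\tilde k(z,x')\,dz ,\qquad x,x'\in D .$$ Then this integral converges absolutely for all $x,x'\in D$, $\hat k$ is symmetric positive semidefinite, and, with $H_{\hat k}(D)$ the reproducing kernel Hilbert space with kernel $\hat k$: (i) The centred Gaussian measure $\Pi_u=N(0,\hat k)$, that is, the probability measure on the space $C(D)$ of continuous real functions (with the $\sigma$-algebra generated by the point evaluations) under which the point evaluations form a centred Gaussian process with covariance function $\hat k$, exists and is unique; the set $H(D)\cap C(D)$ is measurable and $\Pi_u[H(D)]=1$. Moreover, every centred Gaussian process indexed by $D$ with covariance function $\hat k$, on any probability space, has a modification all of whose sample paths belong to $H(D)$. (ii) $H_{\hat k}(D)$ is embedded in $H(D)$, i.e. $H_{\hat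 k}(D)\subseteq H(D)$ and there is a constant $0<c<\infty$ with $\|u\|_{\tilde k}\le c\,\|u\|_{\hat k}$ for all $u\in H_{\hat k}(D)$; and $H_{\hat k}(D)$ is dense in $(H(D),\|\cdot\|_{\tilde k})$. -/

import Mathlib

open MeasureTheory ProbabilityTheory

/-- `H` is a reproducing kernel Hilbert space of real functions on `X` with reproducing kernel `k`:
writing `k_x` for the representer of the evaluation at `x`, one has `k x y = ⟪k_y, k_x⟫`. -/
def HasReproducingKernel {X : Type*} (H : Type*) [NormedAddCommGroup H] [InnerProductSpace ℝ H]
    [CompleteSpace H] [RKHS ℝ H X ℝ] (k : X → X → ℝ) : Prop :=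
  ∀ x y : X, RKHS.kernel H x y (1 : ℝ) = k x y

/-- Lebesgue measure on a (measurable) subset `D` of Euclidean space. -/
noncomputable def lebesgueOn {d : ℕ} (D : Set (EuclideanSpace ℝ (Fin d))) : Measure D :=
  (volume : Measure (EuclideanSpace ℝ (Fin d))).comap Subtype.val

/-- The integral-type kernel `(x, x') ↦ ∫_D k x z * k z x' dz`, with respect to Lebesgue measure
on `D`. -/
noncomputable def integralTypeKernel {d : ℕ} {D : Set (EuclideanSpace ℝ (Fin d))}
    (k : D → D → ℝ) (x x' : D) : ℝ :=
  ∫ z : D, k x z * k z x' ∂(lebesgueOn D)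

/-- `(X x)` is a centred Gaussian process with covariance function `k`. -/
structure IsCentredGaussianProcess {T Ω : Type*} [MeasurableSpace Ω] (X : T → Ω → ℝ)
    (k : T → T → ℝ) (P : Measure Ω) : Prop where
  isGaussianProcess : IsGaussianProcess X P
  mean_eq_zero : ∀ s, ∫ ω, X s ω ∂P = 0
  cov_eq : ∀ s t, cov[X s, X t; P] = k s t

/-- The sigma-algebra on the space of continuous functions that is generated by the point
evaluations. -/
instance continuousMapCylinderMeasurableSpace (X : Type*) [TopologicalSpace X] :
    MeasurableSpace C(X, ℝ) :=
  MeasurableSpace.comap (fun (f : C(X, ℝ)) (x : X) => f x) MeasurableSpace.pi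

/-- `Γ` is the centred Gaussian measure `N(0, k)` on the space of continuous functions: under `Γ`,
the canonical process of point evaluations is a centred Gaussian process with covariance
function `k`. -/
def IsCentredGaussianMeasure {X : Type*} [TopologicalSpace X] (k : X → X → ℝ)
    (Γ : Measure C(X, ℝ)) : Prop :=
  IsCentredGaussianProcess (fun (x : X) (f : C(X, ℝ)) => f x) k Γ

/-! Let `J` be the inclusion of `H` into `L²(D)` and `κ_x` the representer of evaluation at `x`.
Then the integral-type kernel is `⟪J κ_x, J κ_y⟫`, so it is positive semidefinite, with covariance
operator `J* J` on `H`. Bessel gives `∑ e_m(x)² ≤ k x x` for an orthonormal family; integrating, `J`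
is Hilbert-Schmidt. Hence `∑ ξ_i • J* φ_i`, with `φ` a Hilbert basis of `L²` and `ξ` iid standard
normal, converges in `L²(P; H)`, and its law is a Gaussian measure on `H` with the right covariance.
Its image in `C(D)` is `N(0, k̂)`.

Covariance determines the law on a countable dense set `s`. As `H` is Polish and consists of
continuous functions, restriction to `s` is injective with Borel image (Lusin-Souslin), so any
process with this covariance almost surely agrees on `s` with an element of `H`.

For the embedding, `κ_x ↦ κ'_x` extends to a bounded map `H → H'` whose adjoint is the inclusion `H'
→ H`. Its range contains all `J* J κ_x`, so its orthogonal complement lies in `ker (J* J) = ker J =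
0`. -/

section

open Filter Topology RealInnerProductSpace

/-! ### Gaussian series in a Hilbert space -/

/-- The characteristic function at `1` depends continuously on the random variable in `L²`. -/
theorem continuous_integral_exp_mul_I_Lp {Ω : Type*} [MeasurableSpace Ω] (P : Measure Ω)
    [IsProbabilityMeasure P] :
    Continuous fun f : Lp ℝ 2 P => ∫ ω, Complex.exp (f ω * Complex.I) ∂P := by
  have hint : ∀ f : Lp ℝ 2 P, Integrable (fun ω => Complex.exp (f ω * Complex.I)) P := by
    intro f
    refine (integrable_const (1 : ℝ)).mono' ?_ (ae_of_all _ fun ω => ?_)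
    · have := (Lp.stronglyMeasurable f).measurable
      exact (by fun_prop : Measurable fun ω => Complex.exp (f ω * Complex.I)).aestronglyMeasurable
    · rw [Complex.norm_exp_ofReal_mul_I]
  -- `|e^{ia} - e^{ib}| ≤ |a - b|`, and the `L¹` norm is at most the `L²` norm under a probability
  -- measure.
  refine LipschitzWith.continuous (K := 1) (LipschitzWith.of_dist_le_mul fun f g => ?_)
  rw [dist_eq_norm, dist_eq_norm, ← integral_sub (hint f) (hint g), NNReal.coe_one, one_mul]
  have h2 : MemLp (f - g : Lp ℝ 2 P) 2 P := Lp.memLp _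
  have h1 : Integrable (f - g : Lp ℝ 2 P) P := h2.integrable one_le_two
  calc ‖∫ ω, (Complex.exp (f ω * Complex.I) - Complex.exp (g ω * Complex.I)) ∂P‖
      ≤ ∫ ω, ‖(f - g : Lp ℝ 2 P) ω‖ ∂P := by
        refine norm_integral_le_of_norm_le h1.norm ?_
        filter_upwards [Lp.coeFn_sub f g] with ω hω
        rw [hω, Pi.sub_apply]
        have : Complex.exp (f ω * Complex.I) - Complex.exp (g ω * Complex.I)
            = Complex.exp (g ω * Complex.I)
              * (Complex.exp (Complex.I * ((f ω - g ω : ℝ) : ℂ)) - 1) := by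
          rw [mul_sub, ← Complex.exp_add]
          push_cast
          ring_nf
        rw [this, norm_mul, Complex.norm_exp_ofReal_mul_I, one_mul]
        exact Real.norm_exp_I_mul_ofReal_sub_one_le
    _ = (eLpNorm (f - g : Lp ℝ 2 P) 1 P).toReal := by
        rw [integral_norm_eq_lintegral_enorm h1.1, eLpNorm_one_eq_lintegral_enorm]
    _ ≤ (eLpNorm (f - g : Lp ℝ 2 P) 2 P).toReal :=
        ENNReal.toReal_mono h2.eLpNorm_ne_top
          (eLpNorm_le_eLpNorm_of_exponent_le one_le_two h1.1)
    _ = ‖f - g‖ := rfl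

/-- Finite linear combinations of independent standard normal variables are normal. -/
theorem charFun_sum_smul_stdNormal {ι Ω : Type*} [MeasurableSpace Ω] {P : Measure Ω}
    [IsProbabilityMeasure P] {ξ : ι → Ω → ℝ} (hlaw : ∀ i, HasLaw (ξ i) (gaussianReal 0 1) P)
    (hind : iIndepFun ξ P) (s : Finset ι) (c : ι → ℝ) :
    ∫ ω, Complex.exp ((∑ i ∈ s, c i * ξ i ω : ℝ) * Complex.I) ∂P
      = Complex.exp (-((∑ i ∈ s, c i ^ 2 : ℝ)) / 2) := by
  have hm : ∀ i, AEMeasurable (ξ i) P := fun i => (hlaw i).aemeasurable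
  have hlaw' : ∀ i, HasLaw (fun ω => c i * ξ i ω) (gaussianReal 0 (.mk (c i ^ 2) (sq_nonneg _))) P := by
    intro i
    refine ⟨(hm i).const_mul _, ?_⟩
    have h1 : (fun ω => c i * ξ i ω) = (fun x => c i * x) ∘ ξ i := rfl
    rw [h1, ← AEMeasurable.map_map_of_aemeasurable (by fun_prop) (hm i), (hlaw i).map_eq,
      gaussianReal_map_const_mul]
    simp
  have hi : iIndepFun (fun i ω => c i * ξ i ω) P :=
    hind.comp (fun i x => c i * x) (fun i => by fun_prop)
  have hsum := congrFun (iIndepFun.charFun_map_fun_finsetSum_eq_prod (s := s)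
    (fun i _ => (hlaw' i).aemeasurable) (hi.restrict s)) 1
  rw [charFun_apply_real, integral_map (by fun_prop) (by fun_prop), Finset.prod_apply] at hsum
  simp only [(hlaw' _).map_eq, charFun_gaussianReal, ← Complex.exp_sum] at hsum
  simp only [Complex.ofReal_one, one_mul] at hsum
  rw [hsum]
  congr 1
  rw [neg_div, Complex.ofReal_sum, Finset.sum_div, ← Finset.sum_neg_distrib]
  exact Finset.sum_congr rfl fun i _ => by simp

/-- A square-summable family of vectors in a separable Hilbert space is the coefficient family of a
centred Gaussian measure: the law of `∑ i, ξ i • a i`, with `ξ` independent standard normal. -/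
theorem exists_measure_map_inner_eq_gaussianReal {ι H : Type*} [NormedAddCommGroup H]
    [InnerProductSpace ℝ H] [CompleteSpace H] [MeasurableSpace H] [BorelSpace H]
    [SecondCountableTopology H] (a : ι → H) (ha : Summable fun i => ‖a i‖ ^ 2) :
    ∃ μ : Measure H, IsProbabilityMeasure μ ∧ ∀ v : H, μ.map (fun h => ⟪v, h⟫) =
      gaussianReal 0 (∑' i, ⟪v, a i⟫ ^ 2).toNNReal := by
  obtain ⟨Ω, _, P, ξ, hξm, hξ, hind, _⟩ := exists_iid ι (gaussianReal 0 1)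
  have hξL : ∀ i, MemLp (ξ i) 2 P := fun i => by
    have := memLp_id_gaussianReal (μ := 0) (v := 1) 2
    rw [← (hξ i).map_eq, memLp_map_measure_iff (by fun_prop) (by fun_prop)] at this
    exact this
  have hmean : ∀ i, ∫ ω, ξ i ω ∂P = 0 := fun i => by
    rw [(hξ i).integral_eq, integral_id_gaussianReal]
  have hself : ∀ i, ∫ ω, ξ i ω * ξ i ω ∂P = 1 := fun i => by
    have h1 := (hξ i).variance_eq
    rw [variance_id_gaussianReal, variance_of_integral_eq_zero (hξm i).aemeasurable (hmean i)] at h1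
    simpa [sq] using h1
  have hne : ∀ i j, i ≠ j → ∫ ω, ξ i ω * ξ j ω ∂P = 0 := fun i j hij => by
    have := (hind.indepFun hij).integral_mul_eq_mul_integral
      (hξm i).aestronglyMeasurable (hξm j).aestronglyMeasurable
    simpa [hmean] using this
  let Ξ : ι → Lp ℝ 2 P := fun i => (hξL i).toLp
  have hΞ : ∀ i, Ξ i =ᵐ[P] ξ i := fun i => (hξL i).coeFn_toLp
  let Z : ι → Lp H 2 P := fun i => (ContinuousLinearMap.toSpanSingleton ℝ (a i)).compLpL 2 P (Ξ i)
  have hZ : ∀ i, Z i =ᵐ[P] fun ω => ξ i ω • a i := fun i => by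
    filter_upwards [(ContinuousLinearMap.toSpanSingleton ℝ (a i)).coeFn_compLpL (Ξ i), hΞ i]
      with ω h1 h2
    rw [h1, h2, ContinuousLinearMap.toSpanSingleton_apply]
  have hinner : ∀ i j, ⟪Z i, Z j⟫ = ⟪a i, a j⟫ * ∫ ω, ξ i ω * ξ j ω ∂P := fun i j => by
    rw [L2.inner_def, ← integral_const_mul]
    refine integral_congr_ae ?_
    filter_upwards [hZ i, hZ j] with ω h1 h2
    rw [h1, h2, real_inner_smul_left, real_inner_smul_right]
    ring
  -- The `Z i` are orthogonal in `L²(P; H)` with `‖Z i‖ = ‖a i‖`, so square-summability of the norms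
  -- suffices.
  have hsumm : Summable Z := by
    have hV : OrthogonalFamily ℝ (fun i => (ℝ ∙ Z i : Submodule ℝ (Lp H 2 P)))
        (fun i => (ℝ ∙ Z i : Submodule ℝ (Lp H 2 P)).subtypeₗᵢ) := by
      refine OrthogonalFamily.of_pairwise fun i j hij => ?_
      rw [Function.onFun, Submodule.isOrtho_span]
      rintro _ rfl _ rfl
      rw [hinner, hne i j hij, mul_zero]
    refine (hV.summable_iff_norm_sq_summable
      (fun i => ⟨Z i, Submodule.mem_span_singleton_self _⟩)).2 (ha.congr fun i => ?_)
    rw [Submodule.coe_norm, ← real_inner_self_eq_norm_sq (Z i), hinner, hself, mul_one,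
      real_inner_self_eq_norm_sq]
  set W : Lp H 2 P := ∑' i, Z i
  have hWm : AEMeasurable W P := (Lp.stronglyMeasurable W).measurable.aemeasurable
  refine ⟨P.map W, Measure.isProbabilityMeasure_map hWm, fun v => ?_⟩
  have hsq : ∀ v : H, Summable fun i => ⟪v, a i⟫ ^ 2 := fun v => by
    refine (ha.mul_left (‖v‖ ^ 2)).of_nonneg_of_le (fun _ => sq_nonneg _) fun i => ?_
    rw [← mul_pow, sq_le_sq, abs_of_nonneg (by positivity : 0 ≤ ‖v‖ * ‖a i‖)]
    exact abs_real_inner_le_norm _ _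
  have hchar : ∀ v : H, ∫ ω, Complex.exp (⟪v, W ω⟫ * Complex.I) ∂P
      = Complex.exp (-((∑' i, ⟪v, a i⟫ ^ 2 : ℝ)) / 2) := by
    intro v
    let L : Lp H 2 P →L[ℝ] Lp ℝ 2 P := (innerSL ℝ v).compLpL 2 P
    have hL : ∀ f : Lp H 2 P, L f =ᵐ[P] fun ω => ⟪v, f ω⟫ := fun f =>
      (innerSL ℝ v).coeFn_compLpL f
    have h1 : Tendsto (fun s : Finset ι => L (∑ i ∈ s, Z i)) atTop (𝓝 (L W)) :=
      (L.continuous.tendsto W).comp hsumm.hasSum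
    have h2 := ((continuous_integral_exp_mul_I_Lp P).tendsto _).comp h1
    have h3 : ∫ ω, Complex.exp (L W ω * Complex.I) ∂P
        = ∫ ω, Complex.exp (⟪v, W ω⟫ * Complex.I) ∂P := by
      refine integral_congr_ae ?_
      filter_upwards [hL W] with ω h
      rw [h]
    have h4 : ∀ s : Finset ι, ∫ ω, Complex.exp (L (∑ i ∈ s, Z i) ω * Complex.I) ∂P
        = Complex.exp (-((∑ i ∈ s, ⟪v, a i⟫ ^ 2 : ℝ)) / 2) := by
      intro s
      rw [← charFun_sum_smul_stdNormal hξ hind s]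
      refine integral_congr_ae ?_
      rw [map_sum]
      have h5 : ∀ i ∈ s, L (Z i) =ᵐ[P] fun ω => ⟪v, a i⟫ * ξ i ω := fun i _ => by
        filter_upwards [hL (Z i), hZ i] with ω h h'
        rw [h, h', real_inner_smul_right, mul_comm]
      have h6 : ∀ᵐ ω ∂P, ∀ i ∈ s, L (Z i) ω = ⟪v, a i⟫ * ξ i ω :=
        (ae_ball_iff s.countable_toSet).2 h5
      filter_upwards [h6, Lp.coeFn_finsetSum s fun i => L (Z i)] with ω h h'
      rw [h', Finset.sum_apply, Finset.sum_congr rfl h]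
    rw [← h3]
    refine tendsto_nhds_unique h2 ?_
    simp only [Function.comp_def, h4]
    have h7 : Tendsto (fun s : Finset ι => ∑ i ∈ s, ⟪v, a i⟫ ^ 2) atTop
      (𝓝 (∑' i, ⟪v, a i⟫ ^ 2)) := (hsq v).hasSum
    have h8 : Continuous fun x : ℝ => Complex.exp (-(x : ℂ) / 2) := by fun_prop
    exact (h8.tendsto _).comp h7
  have hvm : AEMeasurable (fun ω => ⟪v, W ω⟫) P := by fun_prop
  rw [AEMeasurable.map_map_of_aemeasurable (by fun_prop) hWm, Function.comp_def]
  have : IsProbabilityMeasure (P.map fun ω => ⟪v, W ω⟫) :=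
    Measure.isProbabilityMeasure_map hvm
  refine Measure.ext_of_charFun (funext fun t => ?_)
  rw [charFun_gaussianReal, charFun_apply_real, integral_map hvm (by fun_prop)]
  -- Scaling `v` by `t` turns the value at `1` into the characteristic function at `t`.
  have h9 := hchar (t • v)
  simp only [real_inner_smul_left, mul_pow, tsum_mul_left] at h9
  rw [Real.coe_toNNReal _ (tsum_nonneg fun i => sq_nonneg _)]
  convert h9 using 2
  · push_cast
    rfl
  · push_cast
    ring

/-! ### Laws of centred Gaussian processes -/

namespace IsCentredGaussianProcess

variable {T Ω Ω' : Type*} [MeasurableSpace Ω] [MeasurableSpace Ω'] {X : T → Ω → ℝ}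
  {Y : T → Ω' → ℝ} {k : T → T → ℝ} {P : Measure Ω} {Q : Measure Ω'}

theorem comp_right {S : Type*} (hX : IsCentredGaussianProcess X k P) (f : S → T) :
    IsCentredGaussianProcess (fun s => X (f s)) (fun s t => k (f s) (f t)) P where
  isGaussianProcess := hX.isGaussianProcess.comp_right f
  mean_eq_zero s := hX.mean_eq_zero (f s)
  cov_eq s t := hX.cov_eq (f s) (f t)

theorem memLp_two (hX : IsCentredGaussianProcess X k P) (t : T) : MemLp (X t) 2 P :=
  (hX.isGaussianProcess.hasGaussianLaw_eval t).memLp_two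

-- A Gaussian law is determined by the mean and variance of each functional; here the mean vanishes
-- and the variance expands bilinearly. The right side involves only `k`, which gives uniqueness.
open scoped Classical in
theorem charFunDual_map_restrict (hX : IsCentredGaussianProcess X k P) (I : Finset T)
    (L : StrongDual ℝ (I → ℝ)) :
    charFunDual (P.map fun ω => I.restrict (X · ω)) L =
      Complex.exp (-((∑ i, ∑ j, L (Pi.single j 1) * (L (Pi.single i 1) * k i j) : ℝ)) / 2) := by
  have := hX.isGaussianProcess.isProbabilityMeasure
  have hL : ∀ ω, L (I.restrict (X · ω)) = ∑ i : I, L (Pi.single i 1) * X i ω := by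
    intro ω
    conv_lhs => rw [← Finset.univ_sum_single (I.restrict (X · ω)), map_sum]
    refine Finset.sum_congr rfl fun i _ => ?_
    have : (Pi.single i (I.restrict (X · ω) i) : I → ℝ) = X i ω • Pi.single i (1 : ℝ) := by
      rw [← Pi.single_smul, smul_eq_mul, mul_one]
      rfl
    rw [this, map_smul, smul_eq_mul, mul_comm]
  have hmem : ∀ i : I, MemLp (fun ω => L (Pi.single i 1) * X i ω) 2 P := fun i =>
    (hX.memLp_two i).const_mul _
  rw [(hX.isGaussianProcess.hasGaussianLaw I).charFunDual_map_eq_fun]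
  simp only [hL]
  rw [variance_fun_sum hmem, integral_finsetSum _ fun i _ => (hmem i).integrable one_le_two]
  simp only [integral_const_mul, hX.mean_eq_zero, covariance_const_mul_left,
    covariance_const_mul_right, hX.cov_eq]
  simp [neg_div]

/-- The finite-dimensional laws of a centred Gaussian process are determined by its covariance. -/
theorem map_restrict_eq (hX : IsCentredGaussianProcess X k P)
    (hY : IsCentredGaussianProcess Y k Q) (I : Finset T) :
    (P.map fun ω => I.restrict (X · ω)) = Q.map fun ω => I.restrict (Y · ω) := by
  have := (hX.isGaussianProcess.hasGaussianLaw I).isGaussian_map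
  have := (hY.isGaussianProcess.hasGaussianLaw I).isGaussian_map
  refine Measure.ext_of_charFunDual (funext fun L => ?_)
  rw [hX.charFunDual_map_restrict, hY.charFunDual_map_restrict]

/-- The law of a centred Gaussian process on the product space is determined by its covariance. -/
theorem map_eq (hX : IsCentredGaussianProcess X k P) (hY : IsCentredGaussianProcess Y k Q)
    (hXm : AEMeasurable (fun ω t => X t ω) P) (hYm : AEMeasurable (fun ω t => Y t ω) Q) :
    (P.map fun ω t => X t ω) = Q.map fun ω t => Y t ω := by
  have : ∀ I : Finset T, IsFiniteMeasure (P.map fun ω => I.restrict (X · ω)) := fun I => by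
    have := (hX.isGaussianProcess.hasGaussianLaw I).isGaussian_map
    infer_instance
  refine (isProjectiveLimit_map hXm).unique ?_
  simp only [hX.map_restrict_eq hY]
  exact isProjectiveLimit_map hYm

/-- If one centred Gaussian process has almost all of its paths in a measurable set, then so does
every other one with the same covariance, provided that the index set is countable. -/
theorem ae_mem_of_ae_mem [Countable T] (hX : IsCentredGaussianProcess X k P)
    (hY : IsCentredGaussianProcess Y k Q) {S : Set (T → ℝ)} (hS : MeasurableSet S)
    (h : ∀ᵐ ω ∂Q, (fun t => Y t ω) ∈ S) : ∀ᵐ ω ∂P, (fun t => X t ω) ∈ S := by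
  have hXm : AEMeasurable (fun ω t => X t ω) P :=
    aemeasurable_pi_lambda _ fun t => hX.isGaussianProcess.aemeasurable t
  have hYm : AEMeasurable (fun ω t => Y t ω) Q :=
    aemeasurable_pi_lambda _ fun t => hY.isGaussianProcess.aemeasurable t
  have h' := (ae_map_iff hYm hS).2 h
  rw [← hX.map_eq hY hXm hYm] at h'
  exact (ae_map_iff hXm hS).1 h'

end IsCentredGaussianProcess

/-- A centred Gaussian measure on a Hilbert space, with covariance form `⟪J u, J v⟫`, turns every
family of vectors into a centred Gaussian process. -/
theorem isCentredGaussianProcess_inner {T H E : Type*} [NormedAddCommGroup H]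
    [InnerProductSpace ℝ H] [CompleteSpace H] [MeasurableSpace H] [BorelSpace H]
    [SecondCountableTopology H] [NormedAddCommGroup E] [InnerProductSpace ℝ E] (J : H →L[ℝ] E)
    {μ : Measure H} (hμ : ∀ v : H, μ.map (fun h => ⟪v, h⟫) = gaussianReal 0 (‖J v‖ ^ 2).toNNReal)
    (κ : T → H) :
    IsCentredGaussianProcess (fun t h => ⟪κ t, h⟫) (fun s t => ⟪J (κ s), J (κ t)⟫) μ := by
  have hG : IsGaussian μ := isGaussian_of_map_eq_gaussianReal fun L => by
    refine ⟨0, (‖J ((InnerProductSpace.toDual ℝ H).symm L)‖ ^ 2).toNNReal, ?_⟩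
    rw [← hμ]
    congr with h
    rw [InnerProductSpace.toDual_symm_apply]
  have hlaw : ∀ v : H, HasLaw (fun h => ⟪v, h⟫) (gaussianReal 0 (‖J v‖ ^ 2).toNNReal) μ :=
    fun v => ⟨by fun_prop, hμ v⟩
  have hvar : ∀ v : H, Var[fun h => ⟪v, h⟫; μ] = ‖J v‖ ^ 2 := fun v => by
    rw [(hlaw v).variance_eq, variance_id_gaussianReal, Real.coe_toNNReal _ (sq_nonneg _)]
  have hmem : ∀ v : H, MemLp (fun h => ⟪v, h⟫) 2 μ := fun v =>
    IsGaussian.memLp_dual μ (innerSL ℝ v) 2 (by simp)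
  refine ⟨⟨fun I => ?_⟩, fun s => ?_, fun s t => ?_⟩
  · exact IsGaussian.hasGaussianLaw_id.map
      (ContinuousLinearMap.pi fun i : I => innerSL ℝ (κ i))
  · rw [(hlaw (κ s)).integral_eq, integral_id_gaussianReal]
  · have h1 := variance_fun_add (hmem (κ s)) (hmem (κ t))
    have h2 : (fun h => ⟪κ s, h⟫ + ⟪κ t, h⟫) = fun h : H => ⟪κ s + κ t, h⟫ := by
      funext h
      rw [inner_add_left]
    rw [h2, hvar, hvar, hvar, map_add, norm_add_sq_real] at h1
    linarith

/-- A centred Gaussian measure on the space of continuous functions is determined by its covariance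
function. -/
theorem IsCentredGaussianMeasure.eq {X : Type*} [TopologicalSpace X] {k : X → X → ℝ}
    {Γ Γ' : Measure C(X, ℝ)} (h : IsCentredGaussianMeasure k Γ)
    (h' : IsCentredGaussianMeasure k Γ') : Γ = Γ' := by
  have hm : Measurable fun (f : C(X, ℝ)) (x : X) => f x := comap_measurable _
  have hmap := IsCentredGaussianProcess.map_eq h h' hm.aemeasurable hm.aemeasurable
  ext s hs
  obtain ⟨t, ht, rfl⟩ := hs
  rw [← Measure.map_apply hm ht, hmap, Measure.map_apply hm ht]

/-! ### Evaluations and continuity in a reproducing kernel Hilbert space -/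

namespace RKHS

section Evaluation

variable {X H : Type*} [NormedAddCommGroup H] [InnerProductSpace ℝ H] [CompleteSpace H]
  [RKHS ℝ H X ℝ]

/-- The representer of the evaluation at `x`. -/
noncomputable def representer (H : Type*) {X : Type*} [NormedAddCommGroup H]
    [InnerProductSpace ℝ H] [CompleteSpace H] [RKHS ℝ H X ℝ] (x : X) : H :=
  kerFun H x (1 : ℝ)

theorem inner_representer_left (x : X) (f : H) : ⟪representer H x, f⟫ = f x := by
  simp [representer]

theorem inner_representer_representer {k : X → X → ℝ} (hH : HasReproducingKernel H k) (x y : X) :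
    ⟪representer H x, representer H y⟫ = k x y := by
  rw [inner_representer_left, representer, kerFun_apply, hH]

theorem kernel_symm {k : X → X → ℝ} (hH : HasReproducingKernel H k) (x y : X) : k x y = k y x := by
  rw [← inner_representer_representer hH, real_inner_comm, inner_representer_representer hH]

theorem representer_apply {k : X → X → ℝ} (hH : HasReproducingKernel H k) (x y : X) :
    representer H x y = k x y := by
  rw [← inner_representer_left, inner_representer_representer hH, kernel_symm hH]

theorem norm_representer_sq {k : X → X → ℝ} (hH : HasReproducingKernel H k) (x : X) :
    ‖representer H x‖ ^ 2 = k x x := by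
  rw [← real_inner_self_eq_norm_sq, inner_representer_representer hH]

theorem apply_sq_le {k : X → X → ℝ} (hH : HasReproducingKernel H k) (f : H) (x : X) :
    f x ^ 2 ≤ ‖f‖ ^ 2 * k x x := by
  rw [← norm_representer_sq hH, ← inner_representer_left, ← mul_pow, sq_le_sq,
    abs_of_nonneg (by positivity : 0 ≤ ‖f‖ * ‖representer H x‖), mul_comm]
  exact abs_real_inner_le_norm _ _

theorem eq_zero_of_forall_inner_representer_eq_zero {f : H}
    (h : ∀ x : X, ⟪representer H x, f⟫ = 0) : f = 0 :=
  RKHS.ext fun x => by rw [← inner_representer_left, h, coe_zero, Pi.zero_apply]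

/-- The representers span a dense subspace. -/
theorem topologicalClosure_span_range_representer :
    (Submodule.span ℝ (Set.range (representer H : X → H))).topologicalClosure = ⊤ := by
  refine Submodule.orthogonal_eq_bot_iff.mp ((Submodule.eq_bot_iff _).mpr fun f hf => ?_)
  refine eq_zero_of_forall_inner_representer_eq_zero fun x => ?_
  exact Submodule.inner_right_of_mem_orthogonal
    (Submodule.le_topologicalClosure _ (Submodule.subset_span (Set.mem_range_self x))) hf

/-- Bessel's inequality for point evaluations. -/
theorem sum_apply_sq_le {k : X → X → ℝ} (hH : HasReproducingKernel H k) {ι : Type*} {e : ι → H}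
    (he : Orthonormal ℝ e) (s : Finset ι) (x : X) : ∑ i ∈ s, e i x ^ 2 ≤ k x x := by
  rw [← norm_representer_sq hH]
  refine le_trans (le_of_eq (Finset.sum_congr rfl fun i _ => ?_))
    (he.sum_inner_products_le (representer H x) (s := s))
  rw [real_inner_comm, inner_representer_left, Real.norm_eq_abs, sq_abs]

end Evaluation

section Continuity

variable {X H : Type*} [TopologicalSpace X] [NormedAddCommGroup H] [InnerProductSpace ℝ H]
  [CompleteSpace H] [RKHS ℝ H X ℝ] {k : X → X → ℝ}

theorem continuous_representer (hH : HasReproducingKernel H k)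
    (hk : Continuous fun p : X × X => k p.1 p.2) : Continuous (representer H : X → H) := by
  rw [continuous_iff_continuousAt]
  intro x
  rw [ContinuousAt, tendsto_iff_norm_sub_tendsto_zero]
  have h1 : ∀ y, ‖representer H y - representer H x‖ = √(k y y - 2 * k y x + k x x) := fun y => by
    rw [← norm_representer_sq hH, ← norm_representer_sq hH, ← inner_representer_representer hH,
      ← norm_sub_sq_real, Real.sqrt_sq (norm_nonneg _)]
  simp only [h1]
  have h2 : Continuous fun y => √(k y y - 2 * k y x + k x x) := by
    have ha : Continuous fun y => k y y := hk.comp (continuous_id.prodMk continuous_id)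
    have hb : Continuous fun y => k y x := hk.comp (continuous_id.prodMk continuous_const)
    fun_prop
  convert h2.tendsto x using 2
  rw [eq_comm, Real.sqrt_eq_zero']
  linarith

theorem continuous_coe (hH : HasReproducingKernel H k)
    (hk : Continuous fun p : X × X => k p.1 p.2) (f : H) : Continuous f := by
  have : ⇑f = fun x => ⟪representer H x, f⟫ := funext fun x => (inner_representer_left x f).symm
  rw [this]
  have := continuous_representer hH hk
  fun_prop

/-- The representers form a continuous image of a separable space and have dense span. -/
theorem secondCountableTopology [SecondCountableTopology X] (hH : HasReproducingKernel H k)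
    (hk : Continuous fun p : X × X => k p.1 p.2) : SecondCountableTopology H := by
  have h1 : TopologicalSpace.IsSeparable (Set.range (representer H : X → H)) :=
    TopologicalSpace.isSeparable_range (continuous_representer hH hk)
  have h2 := (h1.span (R := ℝ)).closure
  rw [← Submodule.topologicalClosure_coe, topologicalClosure_span_range_representer,
    Submodule.top_coe, TopologicalSpace.isSeparable_univ_iff] at h2
  exact UniformSpace.secondCountable_of_separable H

/-- The restriction to a countable dense set is a measurable embedding of a reproducing kernel
Hilbert space with continuous kernel. -/
theorem measurableEmbedding_restrict [SecondCountableTopology X] [MeasurableSpace H] [BorelSpace H]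
    (hH : HasReproducingKernel H k) (hk : Continuous fun p : X × X => k p.1 p.2) {s : Set X}
    (hs : s.Countable) (hd : Dense s) :
    MeasurableEmbedding fun (f : H) (x : s) => f x := by
  have := secondCountableTopology hH hk
  have := hs.to_subtype
  -- Lusin-Souslin: a continuous injection of a Polish space is a measurable embedding.
  refine Continuous.measurableEmbedding (continuous_pi fun x => continuous_eval _) fun f g h => ?_
  refine DFunLike.coe_injective ((continuous_coe hH hk f).ext_on hd (continuous_coe hH hk g) ?_)
  exact fun x hx => congrFun h ⟨x, hx⟩

end Continuity

/-! ### The inclusion into `L²` -/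

section L2

variable {X : Type*} [TopologicalSpace X] [MeasurableSpace X] [BorelSpace X] {ν : Measure X}
  {H : Type*} [NormedAddCommGroup H] [InnerProductSpace ℝ H]
  [CompleteSpace H] [RKHS ℝ H X ℝ] {k : X → X → ℝ}

theorem memLp_two_coe (hH : HasReproducingKernel H k) (hk : Continuous fun p : X × X => k p.1 p.2)
    (htr : Integrable (fun x => k x x) ν) (f : H) : MemLp f 2 ν := by
  have hm : AEStronglyMeasurable f ν := (continuous_coe hH hk f).aestronglyMeasurable
  rw [memLp_two_iff_integrable_sq hm]
  refine (htr.const_mul (‖f‖ ^ 2)).mono' (hm.pow 2) (ae_of_all _ fun x => ?_)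
  rw [Real.norm_eq_abs, abs_of_nonneg (sq_nonneg _)]
  exact apply_sq_le hH f x

/-- Integrating `f x ^ 2 ≤ ‖f‖ ^ 2 * k x x` bounds the operator norm by `√(∫ k x x)`. -/
theorem exists_toL2 (hH : HasReproducingKernel H k) (hk : Continuous fun p : X × X => k p.1 p.2)
    (htr : Integrable (fun x => k x x) ν) :
    ∃ J : H →L[ℝ] Lp ℝ 2 ν, ∀ f, J f =ᵐ[ν] f := by
  let hL := memLp_two_coe hH hk htr
  let J₀ : H →ₗ[ℝ] Lp ℝ 2 ν :=
    { toFun f := (hL f).toLp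
      map_add' f g := by
        rw [← MemLp.toLp_add]
        congr 1
        exact coe_add f g
      map_smul' c f := by
        rw [RingHom.id_apply, ← MemLp.toLp_const_smul]
        congr 1
        exact coe_smul f c }
  refine ⟨J₀.mkContinuous √(∫ x, k x x ∂ν) fun f => ?_, fun f => (hL f).coeFn_toLp⟩
  have h0 : 0 ≤ ∫ x, k x x ∂ν := integral_nonneg fun x => by
    rw [← norm_representer_sq hH]
    positivity
  rw [← sq_le_sq₀ (norm_nonneg _) (by positivity), mul_pow, Real.sq_sqrt h0,
    ← real_inner_self_eq_norm_sq, L2.inner_def, mul_comm, ← integral_const_mul]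
  refine integral_mono_ae (L2.integrable_inner _ _) (htr.const_mul _) ?_
  filter_upwards [(hL f).coeFn_toLp] with x hx
  have hx' : J₀ f x = f x := hx
  rw [hx', real_inner_self_eq_norm_sq, Real.norm_eq_abs, sq_abs]
  exact apply_sq_le hH f x

variable {J : H →L[ℝ] Lp ℝ 2 ν}

omit [TopologicalSpace X] [BorelSpace X] [CompleteSpace H] in
theorem inner_toL2 (hJ : ∀ f, J f =ᵐ[ν] f) (f g : H) : ⟪J f, J g⟫ = ∫ x, f x * g x ∂ν := by
  rw [L2.inner_def]
  refine integral_congr_ae ?_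
  filter_upwards [hJ f, hJ g] with x h1 h2
  rw [h1, h2, real_inner_eq_re_inner, RCLike.inner_apply, conj_trivial, mul_comm]
  rfl

omit [TopologicalSpace X] [BorelSpace X] in
theorem inner_toL2_representer (hH : HasReproducingKernel H k) (hJ : ∀ f, J f =ᵐ[ν] f) (x y : X) :
    ⟪J (representer H x), J (representer H y)⟫ = ∫ z, k x z * k z y ∂ν := by
  rw [inner_toL2 hJ]
  simp only [representer_apply hH]
  simp only [kernel_symm hH y]

-- Continuous functions that agree almost everywhere agree everywhere when nonempty open sets have
-- positive measure.
omit [BorelSpace X] in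
theorem toL2_injective [ν.IsOpenPosMeasure] (hH : HasReproducingKernel H k)
    (hk : Continuous fun p : X × X => k p.1 p.2) (hJ : ∀ f, J f =ᵐ[ν] f) :
    Function.Injective J := fun f g h => by
  refine DFunLike.coe_injective
    (((continuous_coe hH hk f).ae_eq_iff_eq ν (continuous_coe hH hk g)).1 ?_)
  filter_upwards [hJ f, hJ g] with x h1 h2
  rw [← h1, ← h2, h]

/-- The inclusion into `L²` is Hilbert-Schmidt. -/
theorem summable_norm_adjoint_toL2_sq (hH : HasReproducingKernel H k)
    (hk : Continuous fun p : X × X => k p.1 p.2) (htr : Integrable (fun x => k x x) ν)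
    (hJ : ∀ f, J f =ᵐ[ν] f) {ι : Type*} {φ : ι → Lp ℝ 2 ν} (hφ : Orthonormal ℝ φ) :
    Summable fun i => ‖J.adjoint (φ i)‖ ^ 2 := by
  obtain ⟨w, b, -⟩ := exists_hilbertBasis ℝ H
  have hJb : ∀ s : Finset w, ∑ m ∈ s, ‖J (b m)‖ ^ 2 ≤ ∫ x, k x x ∂ν := fun s => by
    have h1 : ∀ m, ‖J (b m)‖ ^ 2 = ∫ x, b m x ^ 2 ∂ν := fun m => by
      rw [← real_inner_self_eq_norm_sq, inner_toL2 hJ]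
      simp only [sq]
    have h2 : ∀ m, Integrable (fun x => b m x ^ 2) ν := fun m =>
      (memLp_two_coe hH hk htr (b m)).integrable_sq
    simp only [h1]
    rw [← integral_finsetSum _ fun m _ => h2 m]
    exact integral_mono (integrable_finsetSum _ fun m _ => h2 m) htr
      fun x => sum_apply_sq_le hH b.orthonormal s x
  have hJs : Summable fun m => ‖J (b m)‖ ^ 2 :=
    summable_of_sum_le (fun _ => sq_nonneg _) hJb
  have hexp : ∀ g : Lp ℝ 2 ν, HasSum (fun m => ⟪g, J (b m)⟫ ^ 2) (‖J.adjoint g‖ ^ 2) := fun g => by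
    have := b.hasSum_inner_mul_inner (J.adjoint g) (J.adjoint g)
    rw [real_inner_self_eq_norm_sq] at this
    refine this.congr_fun fun m => ?_
    rw [real_inner_comm (J.adjoint g), ContinuousLinearMap.adjoint_inner_left, sq]
  -- Expand along `b`, exchange the sums and apply Bessel to each `J (b m)`: the Hilbert-Schmidt
  -- norm of the adjoint is at most that of `J`.
  refine summable_of_sum_le (c := ∑' m, ‖J (b m)‖ ^ 2) (fun _ => sq_nonneg _) fun s => ?_
  have h3 := hasSum_sum fun i (_ : i ∈ s) => hexp (φ i)
  rw [← h3.tsum_eq]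
  refine h3.summable.tsum_le_tsum (fun m => ?_) hJs
  refine le_trans (le_of_eq (Finset.sum_congr rfl fun i _ => ?_))
    (hφ.sum_inner_products_le (J (b m)) (s := s))
  rw [Real.norm_eq_abs, sq_abs]

end L2

end RKHS

theorem posSemidef_of_eq_inner {X E : Type*} [NormedAddCommGroup E] [InnerProductSpace ℝ E]
    {k : X → X → ℝ} {v : X → E} (h : ∀ x y, k x y = ⟪v x, v y⟫) : (Matrix.of k).PosSemidef := by
  refine ⟨Matrix.ext fun x y => ?_, fun c => ?_⟩
  · rw [Matrix.conjTranspose_apply, Matrix.of_apply, Matrix.of_apply, h, h, star_trivial,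
      real_inner_comm]
  · have : (c.sum fun i ci => c.sum fun j cj => star ci * k i j * cj)
        = ⟪c.sum fun i ci => ci • v i, c.sum fun i ci => ci • v i⟫ := by
      simp only [Finsupp.sum_inner, Finsupp.inner_sum, real_inner_smul_left,
        real_inner_smul_right, h, star_trivial]
      rw [Finsupp.sum_comm]
      refine Finsupp.sum_congr fun i _ => Finsupp.sum_congr fun j _ => ?_
      rw [real_inner_comm]
      ring
    exact this ▸ real_inner_self_nonneg

/-- The norm of a combination depends only on the Gram matrix. -/
theorem norm_linearCombination_eq {X E F : Type*} [NormedAddCommGroup E] [InnerProductSpace ℝ E]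
    [NormedAddCommGroup F] [InnerProductSpace ℝ F] {u : X → E} {v : X → F}
    (h : ∀ x y, ⟪u x, u y⟫ = ⟪v x, v y⟫) (c : X →₀ ℝ) :
    ‖Finsupp.linearCombination ℝ u c‖ = ‖Finsupp.linearCombination ℝ v c‖ := by
  rw [← sq_eq_sq₀ (norm_nonneg _) (norm_nonneg _), ← real_inner_self_eq_norm_sq,
    ← real_inner_self_eq_norm_sq]
  simp only [Finsupp.linearCombination_apply, Finsupp.sum_inner, Finsupp.inner_sum,
    real_inner_smul_left, real_inner_smul_right, h]

/-- A process is centred Gaussian under an image measure if its pull-back is so. -/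
theorem IsCentredGaussianProcess.map {T Ω Ω' : Type*} [MeasurableSpace Ω] [MeasurableSpace Ω']
    {X : T → Ω' → ℝ} {k : T → T → ℝ} {P : Measure Ω} {g : Ω → Ω'} (hg : Measurable g)
    (hXm : ∀ t, Measurable (X t)) (hX : IsCentredGaussianProcess (fun t ω => X t (g ω)) k P) :
    IsCentredGaussianProcess X k (P.map g) where
  isGaussianProcess := ⟨fun I => ⟨by
    have hm : Measurable fun ω => I.restrict (X · ω) := measurable_pi_lambda _ fun i => hXm i
    rw [Measure.map_map hm hg]
    exact (hX.isGaussianProcess.hasGaussianLaw I).isGaussian_map⟩⟩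
  mean_eq_zero s := by
    rw [integral_map hg.aemeasurable (hXm s).aestronglyMeasurable]
    exact hX.mean_eq_zero s
  cov_eq s t := by
    rw [covariance_map (hXm s).aestronglyMeasurable (hXm t).aestronglyMeasurable hg.aemeasurable]
    exact hX.cov_eq s t

/-! ### Gaussian random elements of `H` and sample paths -/

namespace RKHS

section Gaussian

variable {X : Type*} [TopologicalSpace X] [SecondCountableTopology X] {H : Type*}
  [NormedAddCommGroup H] [InnerProductSpace ℝ H] [CompleteSpace H] [RKHS ℝ H X ℝ]
  {k K : X → X → ℝ}

section

variable [MeasurableSpace H] [BorelSpace H] {μ : Measure H}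

omit [SecondCountableTopology X] in
/-- The law on `C(X)` of a Gaussian random element of a reproducing kernel Hilbert space. -/
theorem exists_isCentredGaussianMeasure (hH : HasReproducingKernel H k)
    (hk : Continuous fun p : X × X => k p.1 p.2)
    (hμ : IsCentredGaussianProcess (fun (x : X) (f : H) => f x) K μ) :
    ∃ Γ : Measure C(X, ℝ), IsCentredGaussianMeasure K Γ := by
  have hm : Measurable fun f : H => (⟨f, continuous_coe hH hk f⟩ : C(X, ℝ)) :=
    measurable_comap_iff.2 (measurable_pi_lambda _ fun x => (continuous_eval x).measurable)
  exact ⟨μ.map _, hμ.map hm fun x => (measurable_pi_apply x).comp (comap_measurable _)⟩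

/-- A Gaussian process with the covariance of a Gaussian random element of a reproducing kernel
Hilbert space agrees with a function of that space on a given countable dense set, almost surely. -/
theorem ae_exists_forall_mem_apply_eq (hH : HasReproducingKernel H k)
    (hk : Continuous fun p : X × X => k p.1 p.2)
    (hμ : IsCentredGaussianProcess (fun (x : X) (f : H) => f x) K μ)
    {Ω : Type*} [MeasurableSpace Ω] {P : Measure Ω} {Y : X → Ω → ℝ}
    (hY : IsCentredGaussianProcess Y K P) {s : Set X} (hs : s.Countable) (hd : Dense s) :
    ∀ᵐ ω ∂P, ∃ f : H, ∀ x ∈ s, f x = Y x ω := by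
  have := hs.to_subtype
  have h := (hY.comp_right ((↑) : s → X)).ae_mem_of_ae_mem (hμ.comp_right ((↑) : s → X))
    (measurableEmbedding_restrict hH hk hs hd).measurableSet_range
    (ae_of_all _ fun f => Set.mem_range_self f)
  filter_upwards [h] with ω ⟨f, hf⟩
  exact ⟨f, fun x hx => congrFun hf ⟨x, hx⟩⟩

/-- A Gaussian process with the covariance of a Gaussian random element of a reproducing kernel
Hilbert space has a modification with paths in that space. -/
theorem exists_modification (hH : HasReproducingKernel H k)
    (hk : Continuous fun p : X × X => k p.1 p.2)
    (hμ : IsCentredGaussianProcess (fun (x : X) (f : H) => f x) K μ)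
    {Ω : Type*} [MeasurableSpace Ω] {P : Measure Ω} {Y : X → Ω → ℝ}
    (hY : IsCentredGaussianProcess Y K P) :
    ∃ Z : X → Ω → ℝ, (∀ x, Z x =ᵐ[P] Y x) ∧ ∀ ω, ∃ f : H, ∀ x, f x = Z x ω := by
  classical
  obtain ⟨s, hs, hd⟩ := TopologicalSpace.exists_countable_dense X
  -- The default `0` puts every path in `H`. Measurability of `F` is not needed, since only almost
  -- sure equality at each `x` is claimed.
  let F : Ω → H := fun ω => if h : ∃ f : H, ∀ x ∈ s, f x = Y x ω then h.choose else 0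
  have hF : ∀ ω, (∃ f : H, ∀ x ∈ s, f x = Y x ω) → ∀ x ∈ s, F ω x = Y x ω := fun ω h => by
    simp only [F, dif_pos h]
    exact h.choose_spec
  refine ⟨fun x ω => F ω x, fun x => ?_, fun ω => ⟨F ω, fun x => rfl⟩⟩
  -- The null set may depend on `x`: use the dense set `insert x s`, and identify the resulting `f`
  -- with `F ω` by continuity and agreement on `s`.
  filter_upwards [ae_exists_forall_mem_apply_eq hH hk hμ hY (hs.insert x)
    (hd.mono (Set.subset_insert x s))] with ω ⟨f, hf⟩
  have hs' : ∀ y ∈ s, f y = Y y ω := fun y hy => hf y (Set.mem_insert_of_mem x hy)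
  have h1 : ⇑(F ω) = ⇑f := (continuous_coe hH hk (F ω)).ext_on hd (continuous_coe hH hk f)
    fun y hy => by rw [hF ω ⟨f, hs'⟩ y hy, hs' y hy]
  rw [h1, hf x (Set.mem_insert x s)]

/-- By continuity, membership in `H` is decided on a countable dense set, so the set is the preimage
of a Borel subset of `ℝ^s`. -/
theorem measure_setOf_exists_coe_eq (hH : HasReproducingKernel H k)
    (hk : Continuous fun p : X × X => k p.1 p.2)
    (hμ : IsCentredGaussianProcess (fun (x : X) (f : H) => f x) K μ) {Γ : Measure C(X, ℝ)}
    (hΓ : IsCentredGaussianMeasure K Γ) :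
    MeasurableSet {f : C(X, ℝ) | ∃ h : H, ⇑h = ⇑f} ∧
      Γ {f : C(X, ℝ) | ∃ h : H, ⇑h = ⇑f} = 1 := by
  obtain ⟨s, hs, hd⟩ := TopologicalSpace.exists_countable_dense X
  have := hΓ.isGaussianProcess.isProbabilityMeasure
  have hext : ∀ (f : C(X, ℝ)) (h : H), (∀ x ∈ s, h x = f x) → ⇑h = ⇑f := fun f h hfh =>
    (continuous_coe hH hk h).ext_on hd f.continuous hfh
  have hr : Measurable fun (f : C(X, ℝ)) (x : s) => f x :=
    measurable_pi_lambda _ fun x => (measurable_pi_apply (x : X)).comp (comap_measurable _)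
  have hmeas : MeasurableSet {f : C(X, ℝ) | ∃ h : H, ⇑h = ⇑f} := by
    convert hr (measurableEmbedding_restrict hH hk hs hd).measurableSet_range using 1
    ext f
    exact ⟨fun ⟨h, hf⟩ => ⟨h, funext fun x => congrFun hf x⟩,
      fun ⟨h, hf⟩ => ⟨h, hext f h fun x hx => congrFun hf ⟨x, hx⟩⟩⟩
  refine ⟨hmeas, (mem_ae_iff_prob_eq_one hmeas).1 ?_⟩
  filter_upwards [ae_exists_forall_mem_apply_eq hH hk hμ hΓ hs hd] with f ⟨h, hf⟩
  exact ⟨h, hext f h hf⟩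

end

variable [MeasurableSpace X] [BorelSpace X] {ν : Measure X}

/-- There is a centred Gaussian random element of the reproducing kernel Hilbert space with kernel
`k` whose covariance function is the integral of `k x z * k z y` over `z`. -/
theorem exists_isCentredGaussianProcess_apply [MeasurableSpace H] [BorelSpace H]
    (hH : HasReproducingKernel H k) (hk : Continuous fun p : X × X => k p.1 p.2)
    (htr : Integrable (fun x => k x x) ν) :
    ∃ μ : Measure H, IsCentredGaussianProcess (fun (x : X) (f : H) => f x)
      (fun x y => ∫ z, k x z * k z y ∂ν) μ := by
  have := secondCountableTopology hH hk
  obtain ⟨J, hJ⟩ := exists_toL2 hH hk htr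
  obtain ⟨w, φ, -⟩ := exists_hilbertBasis ℝ (Lp ℝ 2 ν)
  obtain ⟨μ, -, hμ⟩ := exists_measure_map_inner_eq_gaussianReal _
    (summable_norm_adjoint_toL2_sq hH hk htr hJ φ.orthonormal)
  refine ⟨μ, ?_⟩
  -- Parseval in `L²`: the coefficients `J* φ_i` produce exactly the covariance form of `J`.
  have hsum : ∀ v : H, ∑' i, ⟪v, J.adjoint (φ i)⟫ ^ 2 = ‖J v‖ ^ 2 := fun v => by
    rw [← real_inner_self_eq_norm_sq, ← (φ.hasSum_inner_mul_inner (J v) (J v)).tsum_eq]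
    refine tsum_congr fun i => ?_
    rw [ContinuousLinearMap.adjoint_inner_right, real_inner_comm (J v), sq]
  have := isCentredGaussianProcess_inner J (fun v => by rw [hμ, hsum]) (representer H : X → H)
  simpa only [inner_representer_left, inner_toL2_representer hH hJ] using this

end Gaussian

/-! ### The dense embedding -/

section Embedding

variable {X : Type*} [TopologicalSpace X] [MeasurableSpace X] [BorelSpace X] {ν : Measure X}
  {H : Type*} [NormedAddCommGroup H] [InnerProductSpace ℝ H] [CompleteSpace H] [RKHS ℝ H X ℝ]
  {H' : Type*} [NormedAddCommGroup H'] [InnerProductSpace ℝ H'] [CompleteSpace H'] [RKHS ℝ H' X ℝ]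
  {k : X → X → ℝ}

theorem integrable_kernel_mul_kernel (hH : HasReproducingKernel H k)
    (hk : Continuous fun p : X × X => k p.1 p.2) (htr : Integrable (fun x => k x x) ν) (x y : X) :
    Integrable (fun z => k x z * k z y) ν := by
  have h := (memLp_two_coe hH hk htr (representer H x)).integrable_mul
    (memLp_two_coe hH hk htr (representer H y))
  refine h.congr (ae_of_all _ fun z => ?_)
  simp only [Pi.mul_apply, representer_apply hH]
  rw [kernel_symm hH y z]

theorem posSemidef_integral_kernel_mul_kernel (hH : HasReproducingKernel H k)
    (hk : Continuous fun p : X × X => k p.1 p.2) (htr : Integrable (fun x => k x x) ν) :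
    (Matrix.of fun x y => ∫ z, k x z * k z y ∂ν).PosSemidef := by
  obtain ⟨J, hJ⟩ := exists_toL2 hH hk htr
  exact posSemidef_of_eq_inner fun x y => (inner_toL2_representer hH hJ x y).symm

/-- The reproducing kernel Hilbert space of the integral-type kernel is continuously and densely
embedded. -/
theorem exists_inclusion_denseRange [ν.IsOpenPosMeasure] (hH : HasReproducingKernel H k)
    (hk : Continuous fun p : X × X => k p.1 p.2) (htr : Integrable (fun x => k x x) ν)
    (hH' : HasReproducingKernel H' fun x y => ∫ z, k x z * k z y ∂ν) :
    ∃ i : H' →L[ℝ] H, (∀ f : H', ⇑(i f) = ⇑f) ∧ DenseRange i := by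
  obtain ⟨J, hJ⟩ := exists_toL2 hH hk htr
  let e := Finsupp.linearCombination ℝ (representer H : X → H)
  let e' := Finsupp.linearCombination ℝ (representer H' : X → H')
  have he : DenseRange e := by
    rw [DenseRange, ← LinearMap.coe_range, Submodule.dense_iff_topologicalClosure_eq_top,
      Finsupp.range_linearCombination]
    exact topologicalClosure_span_range_representer
  -- The representers of `H'` have the same Gram matrix as the vectors `J κ_x`, hence `‖e' c‖ = ‖J
  -- (e c)‖`.
  have hbound : ∀ c, ‖e' c‖ ≤ ‖J‖ * ‖e c‖ := fun c => by
    have h1 : ‖e' c‖ = ‖Finsupp.linearCombination ℝ (fun x => J (representer H x)) c‖ :=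
      norm_linearCombination_eq (fun x y => by
        rw [inner_representer_representer hH', inner_toL2_representer hH hJ]) c
    have h2 : Finsupp.linearCombination ℝ (fun x => J (representer H x)) c = J (e c) := by
      simp only [e, Finsupp.linearCombination_apply, Finsupp.sum, map_sum, map_smul]
    rw [h1, h2]
    exact J.le_opNorm _
  let S : H →L[ℝ] H' := e'.extendOfNorm e
  have hS : ∀ x, S (representer H x) = representer H' x := fun x => by
    have := LinearMap.extendOfNorm_eq he ⟨_, hbound⟩ (Finsupp.single x (1 : ℝ))
    simpa [e, e'] using this
  have hi : ∀ f : H', ⇑(S.adjoint f) = ⇑f := fun f => funext fun x => by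
    rw [← inner_representer_left, ContinuousLinearMap.adjoint_inner_right, hS,
      inner_representer_left]
  refine ⟨S.adjoint, hi, ?_⟩
  have hJS : ∀ x, S.adjoint (representer H' x) = J.adjoint (J (representer H x)) := fun x => by
    refine RKHS.ext fun y => ?_
    rw [hi, representer_apply hH', ← inner_representer_left y (J.adjoint _),
      ContinuousLinearMap.adjoint_inner_right, real_inner_comm, inner_toL2_representer hH hJ]
  change Dense (Set.range S.adjoint.toLinearMap)
  rw [← LinearMap.coe_range, Submodule.dense_iff_topologicalClosure_eq_top,
    Submodule.topologicalClosure_eq_top_iff, Submodule.eq_bot_iff]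
  intro h hh
  -- `h` is orthogonal to every `J* J κ_x`; self-adjointness moves `J* J` onto `h`.
  have h1 : J.adjoint (J h) = 0 := eq_zero_of_forall_inner_representer_eq_zero fun x => by
    rw [ContinuousLinearMap.adjoint_inner_right, ← ContinuousLinearMap.adjoint_inner_left, ← hJS]
    exact Submodule.inner_right_of_mem_orthogonal (LinearMap.mem_range_self _ _) hh
  have h2 : J h = 0 := by
    rw [← inner_self_eq_zero (𝕜 := ℝ), ← ContinuousLinearMap.adjoint_inner_left, h1,
      inner_zero_left]
  exact toL2_injective hH hk hJ (by rw [h2, map_zero])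

end Embedding

end RKHS

theorem isOpenPosMeasure_lebesgueOn {d : ℕ} {D : Set (EuclideanSpace ℝ (Fin d))}
    (hD : IsOpen D) : (lebesgueOn D).IsOpenPosMeasure :=
  Measure.IsOpenPosMeasure.comap _ hD.isOpenEmbedding_subtypeVal

end

theorem mainTheorem7 {d : ℕ} (D : Set (EuclideanSpace ℝ (Fin d))) (hD_open : IsOpen D)
    (hD_bdd : Bornology.IsBounded D)
    (k : D → D → ℝ) (hk_cont : Continuous fun p : D × D => k p.1 p.2)
    (hk_trace : Integrable (fun x : D => k x x) (lebesgueOn D))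
    (H : Type*) [NormedAddCommGroup H] [InnerProductSpace ℝ H] [CompleteSpace H] [RKHS ℝ H D ℝ]
    (hH : HasReproducingKernel H k) :
    -- the integral-type kernel is well defined, and it is a kernel
    (∀ x x' : D, Integrable (fun z : D => k x z * k z x') (lebesgueOn D)) ∧
    (Matrix.of (integralTypeKernel k)).PosSemidef ∧
    -- the Gaussian measure `N(0, integralTypeKernel k)` exists, is unique, and is carried by `H(D)`
    (∃! Γ : Measure C(D, ℝ), IsCentredGaussianMeasure (integralTypeKernel k) Γ) ∧
    (∀ Γ : Measure C(D, ℝ), IsCentredGaussianMeasure (integralTypeKernel k) Γ →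
      MeasurableSet {f : C(D, ℝ) | ∃ h : H, ⇑h = ⇑f} ∧ Γ {f : C(D, ℝ) | ∃ h : H, ⇑h = ⇑f} = 1) ∧
    -- every Gaussian process with this law has a modification with all sample paths in `H(D)`
    (∀ (Ω : Type*) [MeasurableSpace Ω] (P : Measure Ω) (X : D → Ω → ℝ),
      IsCentredGaussianProcess X (integralTypeKernel k) P →
      ∃ Y : D → Ω → ℝ, (∀ x, Y x =ᵐ[P] X x) ∧ ∀ ω, ∃ h : H, ∀ x, h x = Y x ω) ∧
    -- the space with kernel `integralTypeKernel k` is embedded in `H(D)`, with dense image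
    (∀ (H' : Type*) [NormedAddCommGroup H'] [InnerProductSpace ℝ H'] [CompleteSpace H']
      [RKHS ℝ H' D ℝ], HasReproducingKernel H' (integralTypeKernel k) →
      (∃ c : ℝ, 0 < c ∧ ∀ f : H', ∃ h : H, ⇑h = ⇑f ∧ ‖h‖ ≤ c * ‖f‖) ∧
      Dense {h : H | ∃ f : H', ⇑h = ⇑f}) := by
  have := isOpenPosMeasure_lebesgueOn hD_open
  let : MeasurableSpace H := borel H
  have : BorelSpace H := ⟨rfl⟩
  obtain ⟨μ, hμ⟩ := RKHS.exists_isCentredGaussianProcess_apply hH hk_cont hk_trace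
  refine ⟨RKHS.integrable_kernel_mul_kernel hH hk_cont hk_trace,
    RKHS.posSemidef_integral_kernel_mul_kernel hH hk_cont hk_trace, ?_,
    fun Γ hΓ => RKHS.measure_setOf_exists_coe_eq hH hk_cont hμ hΓ,
    fun Ω _ P X hX => RKHS.exists_modification hH hk_cont hμ hX, fun H' _ _ _ _ hH' => ?_⟩
  · obtain ⟨Γ, hΓ⟩ := RKHS.exists_isCentredGaussianMeasure hH hk_cont hμ
    exact ⟨Γ, hΓ, fun Γ' hΓ' => IsCentredGaussianMeasure.eq hΓ' hΓ⟩
  · obtain ⟨i, hi, hd⟩ := RKHS.exists_inclusion_denseRange hH hk_cont hk_trace hH'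
    -- The `+ 1` keeps the constant positive when `i = 0`.
    refine ⟨⟨‖i‖ + 1, by positivity, fun f => ⟨i f, hi f, (i.le_opNorm f).trans ?_⟩⟩,
      hd.mono ?_⟩
    · gcongr
      linarith
    · rintro _ ⟨f, rfl⟩
      exact ⟨f, hi f⟩
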